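/- A weighted species $\mathcal{A}^{\alpha}$ is a species of combinatorial structures (a functorial assignment of a finite set $\mathcal{A}[U]$ to every finite set $U$) together with weights $\alpha(A)\in[0,\infty)$ of the structures $A$ that are invariant under relabelling. Write $|A|=|U|$ for $A\in\mathcal{A}[U]$, $\mathcal{A}[n]=\mathcal{A}[\{1,\dots,n\}]$, and $\mathcal{A}^{\alpha}(z)=\sum_{n\ge 0}\frac{z^n}{n!}\sum_{A\in\mathcal{A}[n]}\alpha(A)$. For $d\ge 1$, a power series $g(z)=\sum_{n\ge0} g_nz^n$ with non-negative coefficients and radius of convergence $\rho\in(0,\infty)$ belongs to $\mathscr{S}_d$ if $g_n=0$ whenever $d\nmid n$, $g(\rho)<\infty$, and, as $n\to\infty$ with $n\equiv 0 \bmod d$, $$\frac{g_n}{g_{n+d}}\to\rho^d,\qquad \frac1{g_n}\sum_{i+j=n}g_ig_j\to 2g(\rho).$$ Let $\mathcal{F}^\omega$ and $\mathcal{G}^\nu$ be weighted species with $\mathcal{G}[\emptyset]=\emptyset$ and $[z^k]\mathcal{F}^\omega(z)>0$ for at least one $k\ge 1$. The composition $\mathcal{F}\circ\mathcal{G}$ assigns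 to $U$ the set of all $(F,(G_Q)_{Q\in\pi})$ where $\pi$ is a partition of $U$ into non-empty classes, $F\in\mathcal{F}[\pi]$ and $G_Q\in\mathcal{G}[Q]$, with weight $\mu=\omega(F)\prod_{Q\in\pi}\nu(G_Q)$; its number of components is $c(F,(G_Q)_{Q\in\pi})=|\pi|$. The derived species is $\mathcal{F}'[U]=\mathcal{F}[U\cup\{*\}]$, with the same weights, where $*\notin U$ is a placeholder; $\mathcal{F}'\circ\mathcal{G}$, its weight (again denoted $\mu$) and $c$ on it are defined likewise, so that the placeholder is not counted as a component. **Proposition.** Suppose that $\mathcal{G}^\nu(z)$ belongs to $\mathscr{S}_d$ with radius of convergence $\rho$, and that $\mathcal{F}^\omega(z)$ has radius of convergence strictly larger than $\mathcal{G}^\nu(\rho)$. For $n$ such that $(\mathcal{F}\circ\mathcal{G})[n]$ has positive total weight, let $\mathsf{S}_n$ be a random element of $(\mathcal{F}\circ\mathcal{G})[n]$ drawn with probability proportional to its weight $\mu$. Let $\mathsf{R}$ be a random element of $\bigcup_{m\ge0}(\mathcal{F}'\circ\mathcal{G})[m]$ with the Boltzmann distribution $$\mathbb{P}(\mathsf{R}=R)=\frac{\mu(R)\,\rho^{|R|}/|R|!}{\big((\mathcal{F}')^\omega\circ\mathcal{G}^\nu\big)(\rho)}.$$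 Then $\mathsf{R}$ is well defined, $\mathsf{S}_n$ is well defined for all sufficiently large $n\equiv0\bmod d$, and, as $n\to\infty$ with $n\equiv 0\bmod d$, $$\sup_{E\subseteq\mathbb{N}_0}\big|\mathbb{P}(c(\mathsf{S}_n)\in E)-\mathbb{P}(1+c(\mathsf{R})\in E)\big|\to0,$$ and for every integer $k\ge 0$ the moment $\mathbb{E}[(1+c(\mathsf{R}))^k]$ is finite and $$\mathbb{E}[c(\mathsf{S}_n)^k]\to\mathbb{E}[(1+c(\mathsf{R}))^k].$$ -/

import Mathlib

open scoped NNReal ENNReal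
open Filter Topology MeasureTheory

universe u v

noncomputable section

/-! ## Weighted combinatorial species -/

/-- A combinatorial species with non-negative weights: every finite label set `U` gets a finite set
`obj U` of structures with weights in `[0, ∞)`, and bijections of label sets act functorially and
preserve the weights (functoriality makes each `map σ` a bijection). -/
structure WeightedSpecies where
  obj : (U : Type) → [Finite U] → Type u
  finite_obj : ∀ (U : Type) [Finite U], Finite (obj U)
  map : {U V : Type} → [Finite U] → [Finite V] → (U ≃ V) → obj U → obj V
  map_refl : ∀ {U : Type} [Finite U] (x : obj U), map (Equiv.refl U) x = x
  map_trans : ∀ {U V W : Type} [Finite U] [Finite V] [Finite W] (σ : U ≃ V) (τ : V ≃ W)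
    (x : obj U), map (σ.trans τ) x = map τ (map σ x)
  weight : {U : Type} → [Finite U] → obj U → ℝ≥0
  weight_map : ∀ {U V : Type} [Finite U] [Finite V] (σ : U ≃ V) (x : obj U),
    weight (map σ x) = weight x

namespace WeightedSpecies

instance (A : WeightedSpecies.{u}) (U : Type) [Finite U] : Finite (A.obj U) := A.finite_obj U

/-- Sets of structures carry the discrete σ-algebra. -/
instance (A : WeightedSpecies.{u}) (U : Type) [Finite U] : MeasurableSpace (A.obj U) := ⊤

/-- The exponential generating series: the coefficient of `z ^ n` is the total weight of all
structures on an `n`-element label set, divided by `n!`. -/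
def egf (A : WeightedSpecies.{u}) : PowerSeries ℝ :=
  PowerSeries.mk fun n => (∑ᶠ x : A.obj (Fin n), (A.weight x : ℝ)) / (n.factorial : ℝ)

/-- The set of all structures on the label sets with `0, 1, 2, …` elements. -/
def Universe (A : WeightedSpecies.{u}) : Type u := Σ n : ℕ, A.obj (Fin n)

instance (A : WeightedSpecies.{u}) : MeasurableSpace A.Universe := ⊤

/-- The derived species: structures on `U` together with one placeholder atom `none`. -/
def derived (A : WeightedSpecies.{u}) : WeightedSpecies.{u} where
  obj U _ := A.obj (Option U)
  finite_obj _ _ := inferInstance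
  map σ := A.map σ.optionCongr
  map_refl x := by rw [Equiv.optionCongr_refl]; exact A.map_refl x
  map_trans σ τ x := by rw [← A.map_trans, Equiv.optionCongr_trans]
  weight x := A.weight x
  weight_map σ x := A.weight_map _ x

end WeightedSpecies

/-! ## Composite structures -/

/-- A composite structure on `U`: a partition of `U` into non-empty classes, an `F`-structure on the
set of classes, and a `G`-structure on each class. -/
@[ext]
structure CompositeStructure (F : WeightedSpecies.{u}) (G : WeightedSpecies.{v})
    (U : Type) [Finite U] where
  parts : Set (Set U)
  isPartition : Setoid.IsPartition parts
  outer : F.obj parts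
  inner : (Q : parts) → G.obj (Q : Set U)

namespace CompositeStructure

variable {F : WeightedSpecies.{u}} {G : WeightedSpecies.{v}} {U V : Type}

instance [Finite U] : Finite (CompositeStructure F G U) := by
  let f : CompositeStructure F G U →
      (Σ p : Set (Set U), F.obj p × ((Q : p) → G.obj (Q : Set U))) :=
    fun s => ⟨s.parts, s.outer, s.inner⟩
  refine Finite.of_injective f ?_
  rintro ⟨p, hp, x, g⟩ ⟨p', hp', x', g'⟩ h
  simp only [f, Sigma.mk.injEq] at h
  obtain ⟨rfl, h⟩ := h
  simp only [heq_eq_eq, Prod.mk.injEq] at h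
  obtain ⟨rfl, rfl⟩ := h
  rfl

/-- The number of components, that is, of partition classes. -/
def numComponents [Finite U] (s : CompositeStructure F G U) : ℕ := Nat.card s.parts

/-- The image of a partition under a bijection, `{σ(Q) | Q ∈ p}`. -/
def mapParts (σ : U ≃ V) (p : Set (Set U)) : Set (Set V) := {P | σ ⁻¹' P ∈ p}

theorem mapParts_eq_image (σ : U ≃ V) (p : Set (Set U)) :
    mapParts σ p = (fun Q => σ '' Q) '' p := by
  ext P
  constructor
  · intro h
    exact ⟨σ ⁻¹' P, h, Set.image_preimage_eq P σ.surjective⟩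
  · rintro ⟨Q, hQ, rfl⟩
    change σ ⁻¹' (σ '' Q) ∈ p
    rwa [Set.preimage_image_eq Q σ.injective]

theorem isPartition_mapParts (σ : U ≃ V) {p : Set (Set U)} (hp : Setoid.IsPartition p) :
    Setoid.IsPartition (mapParts σ p) := by
  refine ⟨fun h => hp.1 h, fun y => ?_⟩
  obtain ⟨Q, ⟨hQ, hyQ⟩, huniq⟩ := hp.2 (σ.symm y)
  refine ⟨σ '' Q, ⟨?_, ⟨σ.symm y, hyQ, by simp⟩⟩, ?_⟩
  · change σ ⁻¹' (σ '' Q) ∈ p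
    rwa [Set.preimage_image_eq Q σ.injective]
  · rintro P ⟨hP, hyP⟩
    rw [← huniq (σ ⁻¹' P) ⟨hP, by simpa using hyP⟩, Set.image_preimage_eq P σ.surjective]

/-- The bijection `Q ↦ σ(Q)` between the classes of a partition and those of its image. -/
def partsEquiv (σ : U ≃ V) (p : Set (Set U)) : p ≃ mapParts σ p where
  toFun Q := ⟨σ '' Q, by
    change σ ⁻¹' (σ '' (Q : Set U)) ∈ p
    rw [Set.preimage_image_eq _ σ.injective]; exact Q.2⟩
  invFun P := ⟨σ ⁻¹' P, P.2⟩
  left_inv Q := Subtype.ext (Set.preimage_image_eq _ σ.injective)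
  right_inv P := Subtype.ext (Set.image_preimage_eq _ σ.surjective)

/-- The restriction of `σ` to a bijection from `σ⁻¹(P)` onto `P`. -/
def restrictEquiv (σ : U ≃ V) (P : Set V) : (σ ⁻¹' P : Set U) ≃ P :=
  σ.subtypeEquiv fun _ => Iff.rfl

/-- Transport of a composite structure along a bijection of the label sets. -/
def map [Finite U] [Finite V] (σ : U ≃ V) (s : CompositeStructure F G U) : CompositeStructure F G V where
  parts := mapParts σ s.parts
  isPartition := isPartition_mapParts σ s.isPartition
  outer := F.map (partsEquiv σ s.parts) s.outer
  inner P := G.map (restrictEquiv σ P) (s.inner ⟨σ ⁻¹' (P : Set V), P.2⟩)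

/-- The weight of a composite structure: the weight of the outer structure times the product of the
weights of the structures on the classes. -/
def weight [Finite U] (s : CompositeStructure F G U) : ℝ≥0 :=
  F.weight s.outer * ∏ᶠ Q : s.parts, G.weight (s.inner Q)

end CompositeStructure

namespace WeightedSpecies

/-- The composition `F ∘ G` of two weighted species. -/
def comp (F : WeightedSpecies.{u}) (G : WeightedSpecies.{v}) : WeightedSpecies.{max u v} where
  obj U _ := CompositeStructure F G U
  finite_obj _ _ := inferInstance
  map σ := CompositeStructure.map σ
  map_refl := by
    intro U _ s
    refine CompositeStructure.ext rfl (heq_of_eq ?_) (heq_of_eq ?_)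
    · refine Eq.trans ?_ (F.map_refl s.outer)
      change F.map (CompositeStructure.partsEquiv (Equiv.refl U) s.parts) s.outer = _
      congr 1
      exact Equiv.ext fun Q => Subtype.ext (Set.image_id _)
    · funext P
      exact G.map_refl (s.inner P)
  map_trans := by
    intro U V W _ _ _ σ τ s
    refine CompositeStructure.ext rfl (heq_of_eq ?_) (heq_of_eq ?_)
    · refine Eq.trans ?_ (F.map_trans _ _ s.outer)
      change F.map (CompositeStructure.partsEquiv (σ.trans τ) s.parts) s.outer = _
      congr 1
      exact Equiv.ext fun Q => Subtype.ext (Set.image_comp τ σ _)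
    · funext P
      exact G.map_trans
        (CompositeStructure.restrictEquiv σ (τ ⁻¹' (P : Set W)))
        (CompositeStructure.restrictEquiv τ (P : Set W)) _
  weight s := s.weight
  weight_map := by
    intro U V _ _ σ s
    refine congrArg₂ (· * ·) (F.weight_map _ _) ?_
    refine Eq.trans (finprod_congr fun P => G.weight_map _ _) ?_
    exact finprod_comp_equiv (CompositeStructure.partsEquiv σ s.parts).symm
      (f := fun Q => G.weight (s.inner Q))

end WeightedSpecies

/-! ## Random structures -/

/-- The probability measure that picks `a` with probability proportional to `w a`
(meaningful when the total weight is positive and finite, and the zero measure otherwise). -/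
def proportionalLaw {α : Type u} [MeasurableSpace α] (w : α → ℝ≥0∞) : Measure α :=
  (∑' a, w a)⁻¹ • Measure.sum fun a => w a • Measure.dirac a

namespace WeightedSpecies

/-- The law of a random structure with label set of size `n`, drawn with probability proportional to
its weight. -/
def sizedLaw (A : WeightedSpecies.{u}) (n : ℕ) : Measure (A.obj (Fin n)) :=
  proportionalLaw fun x => (A.weight x : ℝ≥0∞)

/-- The Boltzmann law with parameter `y`: the probability of a structure `x` of size `n` is
proportional to `weight x * y ^ n / n!`. -/
def boltzmannLaw (A : WeightedSpecies.{u}) (y : ℝ) : Measure A.Universe :=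
  proportionalLaw fun x => ENNReal.ofReal ((A.weight x.2 : ℝ) * y ^ x.1 / (x.1.factorial : ℝ))

/-- The number of components of a composite structure. -/
def components {F : WeightedSpecies.{u}} {G : WeightedSpecies.{v}} {U : Type} [Finite U]
    (s : (F.comp G).obj U) : ℕ := CompositeStructure.numComponents s

end WeightedSpecies

/-- The total variation distance of two laws on a countable discrete space. -/
def tvDist {α : Type u} [MeasurableSpace α] (P Q : Measure α) : ℝ :=
  ⨆ E : Set α, |P.real E - Q.real E|

/-! ## Power series -/

/-- The radius of convergence of a real power series. -/
def seriesRadius (g : PowerSeries ℝ) : ℝ≥0∞ :=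
  (FormalMultilinearSeries.ofScalars ℝ fun n => PowerSeries.coeff n g).radius

/-- The value `∑ gₙ xⁿ` of a real power series at `x`. -/
def seriesValue (g : PowerSeries ℝ) (x : ℝ) : ℝ := ∑' n, PowerSeries.coeff n g * x ^ n

/-- The class of subexponential power series with span `d`, the radius of convergence being `ρ`. -/
structure IsSubexponential (d : ℕ) (g : PowerSeries ℝ) (ρ : ℝ) : Prop where
  one_le_span : 1 ≤ d
  coeff_nonneg : ∀ n, 0 ≤ PowerSeries.coeff n g
  radius_pos : 0 < ρ
  radius_eq : seriesRadius g = ENNReal.ofReal ρ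
  coeff_eq_zero : ∀ n, ¬ d ∣ n → PowerSeries.coeff n g = 0
  ratio : Tendsto (fun n => PowerSeries.coeff n g / PowerSeries.coeff (n + d) g)
    (atTop ⊓ 𝓟 {n | d ∣ n}) (𝓝 (ρ ^ d))
  summable : Summable fun n => PowerSeries.coeff n g * ρ ^ n
  convolution : Tendsto (fun n => (PowerSeries.coeff n g)⁻¹ *
      ∑ p ∈ Finset.HasAntidiagonal.antidiagonal n, PowerSeries.coeff p.1 g * PowerSeries.coeff p.2 g)
    (atTop ⊓ 𝓟 {n | d ∣ n}) (𝓝 (2 * seriesValue g ρ))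

end

/-!
Numbering the classes of a partition turns it into a surjection, and surjections onto `{1, …, k}`
weighted by their fibre sizes are counted by multinomial coefficients. Hence the composite
structures of size `n` with `k` components have total weight `n! f_k [zⁿ] g(z)ᵏ`, where `f` and `g`
are the exponential generating series. Relative to `[zⁿ] g`, this tends to `k f_k g(ρ)ᵏ⁻¹`, which is
proportional to the probability that the Boltzmann structure has `k - 1` components.

For `t > g(ρ)` inside the disc of convergence of `f`, the bound `[zⁿ] gᵏ ≤ B tᵏ [zⁿ] g`, uniform in
`k` for large `n`, dominates this convergence, also after multiplication by powers of `k`. Tannery's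
theorem then gives convergence in total variation and of all moments.
-/

theorem summable_of_tsum_pos {α : Type*} {a : α → ℝ} (h : 0 < ∑' x, a x) : Summable a := by
  by_contra hs
  exact h.ne' (tsum_eq_zero_of_not_summable hs)

section Laws

variable {α : Type u} [MeasurableSpace α]

theorem proportionalLaw_apply (w : α → ℝ≥0∞) {s : Set α} (hs : MeasurableSet s) :
    proportionalLaw w s = (∑' x, w x)⁻¹ * ∑' x, w x * s.indicator 1 x := by
  simp [proportionalLaw, Measure.sum_apply _ hs, Measure.dirac_apply' _ hs]

theorem map_proportionalLaw {β : Type v} [MeasurableSpace β] [DecidableEq β] (w : α → ℝ≥0∞)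
    {c : α → β} (hc : Measurable c) :
    (proportionalLaw w).map c = proportionalLaw fun y => ∑' x, if c x = y then w x else 0 := by
  have tsum_fiber_mul (φ : β → ℝ≥0∞) :
      ∑' y, (∑' x, if c x = y then w x else 0) * φ y = ∑' x, w x * φ (c x) := by
    simp_rw [← ENNReal.tsum_mul_right]
    rw [ENNReal.tsum_comm]
    refine tsum_congr fun x => (tsum_eq_single (c x) fun y hy => ?_).trans (by simp)
    simp [hy.symm]
  ext s hs
  rw [Measure.map_apply hc hs, proportionalLaw_apply _ (hc hs), proportionalLaw_apply _ hs,
    tsum_fiber_mul]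
  congr 2
  simpa using (tsum_fiber_mul 1).symm

theorem proportionalLaw_const_mul (w : α → ℝ≥0∞) {r : ℝ≥0∞} (h0 : r ≠ 0) (ht : r ≠ ∞) :
    proportionalLaw (fun x => r * w x) = proportionalLaw w := by
  ext s hs
  rw [proportionalLaw_apply _ hs, proportionalLaw_apply _ hs]
  simp_rw [mul_assoc, ENNReal.tsum_mul_left]
  rw [ENNReal.mul_inv (Or.inl h0) (Or.inl ht), mul_mul_mul_comm, ENNReal.inv_mul_cancel h0 ht,
    one_mul]

/-- The probability measure whose point masses are proportional to the non-negative summable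
real weights `a`; negative weights are truncated to `0`. -/
noncomputable def weightLaw (a : α → ℝ) : Measure α := proportionalLaw fun x => ENNReal.ofReal (a x)

theorem weightLaw_const_mul (a : α → ℝ) {r : ℝ} (hr : 0 < r) :
    weightLaw (fun x => r * a x) = weightLaw a := by
  simp_rw [weightLaw, ENNReal.ofReal_mul hr.le]
  exact proportionalLaw_const_mul _ (ENNReal.ofReal_pos.2 hr).ne' ENNReal.ofReal_ne_top

section WeightLaw

variable {a : α → ℝ}

theorem isProbabilityMeasure_weightLaw (ha : ∀ x, 0 ≤ a x) (hpos : 0 < ∑' x, a x) :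
    IsProbabilityMeasure (weightLaw a) := by
  have hs := summable_of_tsum_pos hpos
  constructor
  rw [weightLaw, proportionalLaw_apply _ MeasurableSet.univ]
  simp only [Set.indicator_univ, Pi.one_apply, mul_one]
  rw [← ENNReal.ofReal_tsum_of_nonneg ha hs]
  exact ENNReal.inv_mul_cancel (ENNReal.ofReal_pos.2 hpos).ne' ENNReal.ofReal_ne_top

variable [Countable α] [MeasurableSingletonClass α]

theorem integral_weightLaw (ha : ∀ x, 0 ≤ a x) (hs : Summable a) (φ : α → ℝ) :
    ∫ x, φ x ∂weightLaw a = (∑' x, a x)⁻¹ * ∑' x, a x * φ x := by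
  rw [weightLaw, proportionalLaw, integral_smul_measure,
    integral_sum_dirac fun _ => ENNReal.ofReal_ne_top, ← ENNReal.ofReal_tsum_of_nonneg ha hs,
    ENNReal.toReal_inv, ENNReal.toReal_ofReal (tsum_nonneg ha)]
  simp only [ENNReal.toReal_ofReal (ha _), smul_eq_mul]

theorem measureReal_singleton_weightLaw (ha : ∀ x, 0 ≤ a x) (hs : Summable a) (x : α) :
    (weightLaw a).real {x} = a x / ∑' y, a y := by
  rw [← integral_indicator_one (measurableSet_singleton x), integral_weightLaw ha hs,
    div_eq_inv_mul]
  congr 1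
  exact (tsum_eq_single x fun y hy => by simp [hy]).trans (by simp)

theorem integrable_weightLaw (ha : ∀ x, 0 ≤ a x) (hpos : 0 < ∑' x, a x) {φ : α → ℝ}
    (hφ : Summable fun x => a x * |φ x|) : Integrable φ (weightLaw a) := by
  have hs := summable_of_tsum_pos hpos
  refine Integrable.smul_measure ?_ ?_
  · refine integrable_sum_dirac (fun _ => ENNReal.ofReal_ne_top) ?_
    simpa [ENNReal.toReal_ofReal (ha _)] using hφ
  · rw [← ENNReal.ofReal_tsum_of_nonneg ha hs]
    exact ENNReal.inv_ne_top.2 (ENNReal.ofReal_pos.2 hpos).ne'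

end WeightLaw

section TotalVariation

theorem tvDist_nonneg (P Q : Measure α) : 0 ≤ tvDist P Q :=
  Real.iSup_nonneg fun _ => abs_nonneg _

variable [Countable α] [MeasurableSingletonClass α]

theorem hasSum_indicator_measureReal_singleton (P : Measure α) [IsFiniteMeasure P] (E : Set α) :
    HasSum (E.indicator fun x => P.real {x}) (P.real E) := by
  have hE := P.tsum_indicator_apply_singleton E E.to_countable.measurableSet
  have h := ENNReal.hasSum_toReal (hE ▸ measure_ne_top P E)
  rw [← ENNReal.tsum_toReal_eq fun x => by
    by_cases hx : x ∈ E <;> simp [hx, measure_ne_top], hE] at h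
  refine h.congr_fun fun x => ?_
  by_cases hx : x ∈ E <;> simp [hx, measureReal_def]

theorem tvDist_le_tsum_abs_sub (P Q : Measure α) [IsFiniteMeasure P] [IsFiniteMeasure Q] :
    tvDist P Q ≤ ∑' x, |P.real {x} - Q.real {x}| := by
  have hsum (E : Set α) := (hasSum_indicator_measureReal_singleton P E).sub
    (hasSum_indicator_measureReal_singleton Q E)
  have habs : Summable fun x => |P.real {x} - Q.real {x}| := by
    simpa using (hsum Set.univ).summable.abs
  refine ciSup_le fun E => ?_
  rw [← (hsum E).tsum_eq]
  refine (norm_tsum_le_tsum_norm (hsum E).summable.norm).trans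
    ((hsum E).summable.norm.tsum_le_tsum (fun x => ?_) habs)
  by_cases hx : x ∈ E <;> simp [hx]

end TotalVariation

end Laws

/-- Pointwise convergence of non-negative functions `a i` to `b` along `l`, dominated by the
summable function `D`: the hypotheses of Tannery's theorem. -/
structure DominatedTendsto {ι : Type*} {α : Type u} (l : Filter ι) (a : ι → α → ℝ) (b D : α → ℝ) :
    Prop where
  nonneg : ∀ᶠ i in l, ∀ x, 0 ≤ a i x
  le_bound : ∀ᶠ i in l, ∀ x, a i x ≤ D x
  tendsto : ∀ x, Tendsto (a · x) l (𝓝 (b x))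
  summable_bound : Summable D

namespace DominatedTendsto

variable {ι : Type*} {α : Type u} {l : Filter ι} {a : ι → α → ℝ} {b D : α → ℝ}

theorem eventually_summable (h : DominatedTendsto l a b D) : ∀ᶠ i in l, Summable (a i) := by
  filter_upwards [h.nonneg, h.le_bound] with i h0 hD
  exact .of_nonneg_of_le h0 hD h.summable_bound

theorem tendsto_tsum_mul (h : DominatedTendsto l a b D) {φ : α → ℝ}
    (hφ : Summable fun x => D x * |φ x|) :
    Tendsto (fun i => ∑' x, a i x * φ x) l (𝓝 (∑' x, b x * φ x)) := by
  refine tendsto_tsum_of_dominated_convergence hφ (fun x => (h.tendsto x).mul_const _) ?_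
  filter_upwards [h.nonneg, h.le_bound] with i h0 hD x
  rw [norm_mul, Real.norm_of_nonneg (h0 x), Real.norm_eq_abs]
  exact mul_le_mul_of_nonneg_right (hD x) (abs_nonneg _)

theorem tendsto_tsum (h : DominatedTendsto l a b D) :
    Tendsto (fun i => ∑' x, a i x) l (𝓝 (∑' x, b x)) := by
  simpa using h.tendsto_tsum_mul (φ := 1) (by simpa using h.summable_bound)

theorem eventually_tsum_pos (h : DominatedTendsto l a b D) (hb : 0 < ∑' x, b x) :
    ∀ᶠ i in l, 0 < ∑' x, a i x :=
  h.tendsto_tsum.eventually (lt_mem_nhds hb)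

section Limit

variable [l.NeBot]

theorem limit_nonneg (h : DominatedTendsto l a b D) (x : α) : 0 ≤ b x :=
  ge_of_tendsto (h.tendsto x) (h.nonneg.mono fun _ h0 => h0 x)

theorem limit_le_bound (h : DominatedTendsto l a b D) (x : α) : b x ≤ D x :=
  le_of_tendsto (h.tendsto x) (h.le_bound.mono fun _ hD => hD x)

theorem bound_nonneg (h : DominatedTendsto l a b D) (x : α) : 0 ≤ D x :=
  (h.limit_nonneg x).trans (h.limit_le_bound x)

theorem summable_limit (h : DominatedTendsto l a b D) : Summable b :=
  .of_nonneg_of_le h.limit_nonneg h.limit_le_bound h.summable_bound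

theorem tendsto_tsum_abs_sub (h : DominatedTendsto l a b D) :
    Tendsto (fun i => ∑' x, |a i x - b x|) l (𝓝 0) := by
  rw [← tsum_zero (β := α)]
  refine tendsto_tsum_of_dominated_convergence h.summable_bound (fun x => ?_) ?_
  · simpa using ((h.tendsto x).sub_const (b x)).abs
  · filter_upwards [h.nonneg, h.le_bound] with i h0 hD x
    rw [Real.norm_of_nonneg (abs_nonneg _), abs_sub_le_iff]
    constructor <;> linarith [h0 x, hD x, h.limit_nonneg x, h.limit_le_bound x]

theorem normalize (h : DominatedTendsto l a b D) (hb : 0 < ∑' x, b x) :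
    DominatedTendsto l (fun i x => a i x / ∑' y, a i y) (fun x => b x / ∑' y, b y)
      fun x => D x / ((∑' y, b y) / 2) where
  nonneg := by
    filter_upwards [h.nonneg] with i h0 x
    exact div_nonneg (h0 x) (tsum_nonneg h0)
  le_bound := by
    filter_upwards [h.le_bound, h.tendsto_tsum.eventually (lt_mem_nhds (half_lt_self hb))]
      with i hD hhalf x
    exact div_le_div₀ (h.bound_nonneg x) (hD x) (half_pos hb) hhalf.le
  tendsto x := (h.tendsto x).div h.tendsto_tsum hb.ne'
  summable_bound := h.summable_bound.div_const _

end Limit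

section WeightLaw

variable [MeasurableSpace α]

theorem isProbabilityMeasure_weightLaw (h : DominatedTendsto l a b D) (hb : 0 < ∑' x, b x) :
    ∀ᶠ i in l, IsProbabilityMeasure (weightLaw (a i)) := by
  filter_upwards [h.nonneg, h.eventually_tsum_pos hb] with i h0 hpos
  exact _root_.isProbabilityMeasure_weightLaw h0 hpos

theorem isProbabilityMeasure_weightLaw_limit [l.NeBot] (h : DominatedTendsto l a b D)
    (hb : 0 < ∑' x, b x) : IsProbabilityMeasure (weightLaw b) :=
  _root_.isProbabilityMeasure_weightLaw h.limit_nonneg hb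

variable [l.NeBot] [Countable α] [MeasurableSingletonClass α]

theorem tendsto_tvDist_weightLaw (h : DominatedTendsto l a b D) (hb : 0 < ∑' x, b x) :
    Tendsto (fun i => tvDist (weightLaw (a i)) (weightLaw b)) l (𝓝 0) := by
  refine tendsto_of_tendsto_of_tendsto_of_le_of_le' tendsto_const_nhds
    (h.normalize hb).tendsto_tsum_abs_sub (.of_forall fun _ => tvDist_nonneg _ _) ?_
  filter_upwards [h.nonneg, h.eventually_summable, h.isProbabilityMeasure_weightLaw hb]
    with i h0 hs _
  have := h.isProbabilityMeasure_weightLaw_limit hb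
  refine (tvDist_le_tsum_abs_sub _ _).trans_eq (tsum_congr fun x => ?_)
  rw [measureReal_singleton_weightLaw h0 hs,
    measureReal_singleton_weightLaw h.limit_nonneg h.summable_limit]

variable {φ : α → ℝ}

theorem integrable_weightLaw_limit (h : DominatedTendsto l a b D) (hb : 0 < ∑' x, b x)
    (hφ : Summable fun x => D x * |φ x|) : Integrable φ (weightLaw b) := by
  refine integrable_weightLaw h.limit_nonneg hb (.of_nonneg_of_le (fun x => ?_) (fun x => ?_) hφ)
  · exact mul_nonneg (h.limit_nonneg x) (abs_nonneg _)
  · exact mul_le_mul_of_nonneg_right (h.limit_le_bound x) (abs_nonneg _)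

theorem tendsto_integral_weightLaw (h : DominatedTendsto l a b D) (hb : 0 < ∑' x, b x)
    (hφ : Summable fun x => D x * |φ x|) :
    Tendsto (fun i => ∫ x, φ x ∂weightLaw (a i)) l (𝓝 (∫ x, φ x ∂weightLaw b)) := by
  rw [integral_weightLaw h.limit_nonneg h.summable_limit]
  refine ((h.tendsto_tsum.inv₀ hb.ne').mul (h.tendsto_tsum_mul hφ)).congr' ?_
  filter_upwards [h.nonneg, h.eventually_summable] with i h0 hs
  rw [integral_weightLaw h0 hs]

end WeightLaw

end DominatedTendsto

section PowerSeries

open PowerSeries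

theorem coeff_mul_eq_sum_range_add_sum_Ico {R : Type*} [Semiring R] (f g : PowerSeries R)
    {M n : ℕ} (hM : M ≤ n + 1) :
    coeff n (f * g) = ∑ i ∈ Finset.range M, coeff i f * coeff (n - i) g +
      ∑ i ∈ Finset.Ico M (n + 1), coeff i f * coeff (n - i) g := by
  rw [coeff_mul, Finset.Nat.sum_antidiagonal_eq_sum_range_succ (fun i j => coeff i f * coeff j g),
    Finset.sum_range_add_sum_Ico _ hM]

theorem coeff_pow_nonneg {R : Type*} [Semiring R] [PartialOrder R] [IsOrderedRing R]
    {g : PowerSeries R} (hg : ∀ n, 0 ≤ coeff n g) (k n : ℕ) : 0 ≤ coeff n (g ^ k) := by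
  induction k generalizing n with
  | zero =>
    rw [pow_zero, coeff_one]
    split_ifs
    exacts [zero_le_one, le_rfl]
  | succ k ih =>
    rw [pow_succ, coeff_mul]
    exact Finset.sum_nonneg fun p _ => mul_nonneg (ih _) (hg _)

theorem hasSum_coeff_mul {f g : PowerSeries ℝ} {s t : ℝ} (hf : HasSum (fun n => coeff n f) s)
    (hg : HasSum (fun n => coeff n g) t) : HasSum (fun n => coeff n (f * g)) (s * t) := by
  have hf' : Summable fun n => ‖coeff n f‖ := hf.summable.norm
  have hg' : Summable fun n => ‖coeff n g‖ := hg.summable.norm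
  simp_rw [coeff_mul]
  rw [← hf.tsum_eq, ← hg.tsum_eq,
    tsum_mul_tsum_eq_tsum_sum_antidiagonal_of_summable_norm hf' hg']
  exact (summable_norm_sum_mul_antidiagonal_of_summable_norm hf' hg').of_norm.hasSum

theorem hasSum_coeff_pow {g : PowerSeries ℝ} {s : ℝ} (hg : HasSum (fun n => coeff n g) s)
    (k : ℕ) : HasSum (fun n => coeff n (g ^ k)) (s ^ k) := by
  induction k with
  | zero => simpa only [pow_zero, coeff_one] using hasSum_ite_eq 0 (1 : ℝ)
  | succ k ih => simpa only [pow_succ] using hasSum_coeff_mul ih hg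

theorem summable_coeff_mul_pow_mul_pow {f : PowerSeries ℝ} {t : ℝ} (ht0 : 0 ≤ t)
    (ht : ENNReal.ofReal t < seriesRadius f) (m : ℕ) :
    Summable fun k : ℕ => coeff k f * t ^ k * (k : ℝ) ^ m := by
  obtain ⟨a, ⟨ha0, ha1⟩, C, -, hle⟩ :=
    FormalMultilinearSeries.norm_mul_pow_le_mul_pow_of_lt_radius _ ht
  have hgeom : Summable fun k : ℕ => C * ((k : ℝ) ^ m * a ^ k) :=
    (summable_pow_mul_geometric_of_norm_lt_one m
      (by rwa [Real.norm_of_nonneg ha0.le])).mul_left C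
  refine .of_norm_bounded hgeom fun k => ?_
  have hk := hle k
  rw [FormalMultilinearSeries.ofScalars_norm, Real.coe_toNNReal t ht0] at hk
  calc ‖coeff k f * t ^ k * (k : ℝ) ^ m‖ = ‖coeff k f‖ * t ^ k * (k : ℝ) ^ m := by
        simp [abs_of_nonneg ht0]
    _ ≤ C * a ^ k * (k : ℝ) ^ m := by gcongr
    _ = C * ((k : ℝ) ^ m * a ^ k) := by ring

theorem seriesRadius_zero : seriesRadius 0 = ⊤ := by
  have hcoeff : (fun n => coeff n (0 : PowerSeries ℝ)) = 0 := funext fun n => map_zero _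
  rw [seriesRadius, hcoeff, FormalMultilinearSeries.ofScalars_series_eq_zero_of_scalar_zero,
    FormalMultilinearSeries.zero_radius]

/-- The defining properties of a subexponential series `q` of span `1` and radius of convergence
`1`, where `s` is the sum of its coefficients. Every subexponential series reduces to this case by
rescaling the variable and dropping the coefficients outside `d ℕ`. -/
structure IsUnitSubexponential (q : PowerSeries ℝ) (s : ℝ) : Prop where
  coeff_nonneg : ∀ n, 0 ≤ coeff n q
  hasSum : HasSum (fun n => coeff n q) s
  eventually_pos : ∀ᶠ n in atTop, 0 < coeff n q
  ratio : Tendsto (fun n => coeff n q / coeff (n + 1) q) atTop (𝓝 1)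
  sq : Tendsto (fun n => coeff n (q ^ 2) / coeff n q) atTop (𝓝 (2 * s))

namespace IsUnitSubexponential

variable {q : PowerSeries ℝ} {s : ℝ}

theorem sum_pos (h : IsUnitSubexponential q s) : 0 < s := by
  obtain ⟨n, hn⟩ := h.eventually_pos.exists
  exact hn.trans_le (le_hasSum h.hasSum n fun m _ => h.coeff_nonneg m)

theorem coeff_pow_le (h : IsUnitSubexponential q s) (k n : ℕ) : coeff n (q ^ k) ≤ s ^ k :=
  le_hasSum (hasSum_coeff_pow h.hasSum k) n fun m _ => coeff_pow_nonneg h.coeff_nonneg k m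

theorem tendsto_coeff_div_coeff_add (h : IsUnitSubexponential q s) (i : ℕ) :
    Tendsto (fun n => coeff n q / coeff (n + i) q) atTop (𝓝 1) := by
  induction i with
  | zero =>
    refine tendsto_const_nhds.congr' ?_
    filter_upwards [h.eventually_pos] with n hn
    rw [add_zero, div_self hn.ne']
  | succ i ih =>
    have hmul := ih.mul ((tendsto_add_atTop_iff_nat i).2 h.ratio)
    rw [one_mul] at hmul
    refine hmul.congr' ?_
    filter_upwards [(tendsto_add_atTop_nat i).eventually h.eventually_pos] with n hn
    rw [div_mul_div_cancel₀ hn.ne', add_assoc]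

theorem tendsto_coeff_sub_div_coeff (h : IsUnitSubexponential q s) (i : ℕ) :
    Tendsto (fun n => coeff (n - i) q / coeff n q) atTop (𝓝 1) := by
  rw [← tendsto_add_atTop_iff_nat i]
  simpa using h.tendsto_coeff_div_coeff_add i

theorem tendsto_head (h : IsUnitSubexponential q s) (r : ℕ → ℝ) (M : ℕ) :
    Tendsto (fun n => (∑ i ∈ Finset.range M, r i * coeff (n - i) q) / coeff n q) atTop
      (𝓝 (∑ i ∈ Finset.range M, r i)) := by
  simp_rw [Finset.sum_div, mul_div_assoc]
  refine tendsto_finsetSum _ fun i _ => ?_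
  simpa using (h.tendsto_coeff_sub_div_coeff i).const_mul (r i)

theorem tendsto_tail (h : IsUnitSubexponential q s) (M : ℕ) :
    Tendsto (fun n => (∑ i ∈ Finset.Ico M (n + 1), coeff i q * coeff (n - i) q) / coeff n q) atTop
      (𝓝 (2 * s - ∑ i ∈ Finset.range M, coeff i q)) := by
  refine (h.sq.sub (h.tendsto_head (fun i => coeff i q) M)).congr' ?_
  filter_upwards [eventually_ge_atTop M] with n hn
  rw [← sub_div, pow_two, coeff_mul_eq_sum_range_add_sum_Ico q q (by omega : M ≤ n + 1),
    add_sub_cancel_left]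

theorem abs_tail_le (h : IsUnitSubexponential q s) {r : ℕ → ℝ} {δ : ℝ} {M : ℕ}
    (hr : ∀ i ≥ M, |r i| ≤ δ * coeff i q) (n : ℕ) :
    |∑ i ∈ Finset.Ico M (n + 1), r i * coeff (n - i) q| ≤
      δ * ∑ i ∈ Finset.Ico M (n + 1), coeff i q * coeff (n - i) q := by
  rw [Finset.mul_sum]
  refine (Finset.abs_sum_le_sum_abs _ _).trans (Finset.sum_le_sum fun i hi => ?_)
  rw [abs_mul, abs_of_nonneg (h.coeff_nonneg _), ← mul_assoc]
  exact mul_le_mul_of_nonneg_right (hr i (Finset.mem_Ico.1 hi).1) (h.coeff_nonneg _)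

theorem tendsto_coeff_mul_of_isLittleO (h : IsUnitSubexponential q s) {r : PowerSeries ℝ} {t : ℝ}
    (hr : HasSum (fun n => coeff n r) t)
    (hrq : (fun n => coeff n r) =o[atTop] fun n => coeff n q) :
    Tendsto (fun n => coeff n (r * q) / coeff n q) atTop (𝓝 t) := by
  have hs := h.sum_pos
  refine Metric.tendsto_nhds.2 fun ε hε => ?_
  set δ : ℝ := ε / (6 * s + 3) with hδ
  have hδε : δ * (2 * s + 1) = ε / 3 := by rw [hδ]; field_simp; ring
  have hsmall : ∀ᶠ n in atTop, |coeff n r| ≤ δ * coeff n q :=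
    (hrq.bound (by positivity : 0 < δ)).mono fun n hn => by
      simpa [abs_of_nonneg (h.coeff_nonneg n)] using hn
  have hpartial : ∀ᶠ M in atTop, |∑ i ∈ Finset.range M, coeff i r - t| < ε / 3 :=
    hr.tendsto_sum_nat.eventually (Metric.ball_mem_nhds t (by positivity : 0 < ε / 3))
  obtain ⟨M, hM, hMt⟩ := ((eventually_forall_ge_atTop.2 hsmall).and hpartial).exists
  have hhead : ∀ᶠ n in atTop,
      |(∑ i ∈ Finset.range M, coeff i r * coeff (n - i) q) / coeff n q -
        ∑ i ∈ Finset.range M, coeff i r| < ε / 3 :=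
    (h.tendsto_head (fun i => coeff i r) M).eventually
      (Metric.ball_mem_nhds _ (by positivity : 0 < ε / 3))
  have htail : ∀ᶠ n in atTop,
      (∑ i ∈ Finset.Ico M (n + 1), coeff i q * coeff (n - i) q) / coeff n q < 2 * s + 1 := by
    refine (h.tendsto_tail M).eventually (gt_mem_nhds ?_)
    linarith [Finset.sum_nonneg fun i (_ : i ∈ Finset.range M) => h.coeff_nonneg i]
  filter_upwards [hhead, htail, h.eventually_pos, eventually_ge_atTop M] with n hn hn' hpos hMn
  have hrest : |(∑ i ∈ Finset.Ico M (n + 1), coeff i r * coeff (n - i) q) / coeff n q| ≤ ε / 3 := by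
    rw [abs_div, abs_of_pos hpos, ← hδε]
    refine (div_le_div_of_nonneg_right (h.abs_tail_le hM n) hpos.le).trans ?_
    rw [mul_div_assoc]
    gcongr
  rw [Real.dist_eq, coeff_mul_eq_sum_range_add_sum_Ico r q (by omega : M ≤ n + 1), add_div]
  rw [abs_lt] at hn hMt ⊢
  rw [abs_le] at hrest
  constructor <;> linarith

theorem tendsto_coeff_mul (h : IsUnitSubexponential q s) {r : PowerSeries ℝ} {t c : ℝ}
    (hr : HasSum (fun n => coeff n r) t)
    (hrq : Tendsto (fun n => coeff n r / coeff n q) atTop (𝓝 c)) :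
    Tendsto (fun n => coeff n (r * q) / coeff n q) atTop (𝓝 (t + c * s)) := by
  have hsum : HasSum (fun n => coeff n (r - c • q)) (t - c * s) := by
    simpa using hr.sub (h.hasSum.mul_left c)
  have hsmall : (fun n => coeff n (r - c • q)) =o[atTop] fun n => coeff n q := by
    refine (Asymptotics.isLittleO_iff_tendsto' ?_).2 ?_
    · filter_upwards [h.eventually_pos] with n hn h0
      exact absurd h0 hn.ne'
    · refine (sub_self c ▸ hrq.sub_const c).congr' ?_
      filter_upwards [h.eventually_pos] with n hn
      rw [map_sub, coeff_smul, smul_eq_mul, sub_div, mul_div_cancel_right₀ _ hn.ne']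
  have hlim := (h.tendsto_coeff_mul_of_isLittleO hsum hsmall).add (h.sq.const_mul c)
  rw [show t - c * s + c * (2 * s) = t + c * s by ring] at hlim
  refine hlim.congr fun n => ?_
  rw [sub_mul, smul_mul_assoc, ← pow_two, map_sub, coeff_smul]
  ring

theorem tendsto_coeff_pow (h : IsUnitSubexponential q s) (k : ℕ) :
    Tendsto (fun n => coeff n (q ^ k) / coeff n q) atTop (𝓝 (k * s ^ (k - 1))) := by
  induction k with
  | zero =>
    refine tendsto_const_nhds.congr' ?_
    filter_upwards [eventually_gt_atTop 0] with n hn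
    simp [coeff_one, hn.ne']
  | succ k ih =>
    have hlim := h.tendsto_coeff_mul (hasSum_coeff_pow h.hasSum k) ih
    simp_rw [← pow_succ q] at hlim
    convert hlim using 2
    cases k with
    | zero => simp
    | succ k => push_cast [Nat.add_sub_cancel]; ring

theorem exists_tail_le (h : IsUnitSubexponential q s) {u : ℝ} (hu : s < u) :
    ∃ M > 0, ∀ n ≥ M, 0 < coeff n q ∧
      ∑ i ∈ Finset.Ico M (n + 1), coeff i q * coeff (n - i) q ≤ u * coeff n q := by
  obtain ⟨J, hJ⟩ : ∃ J, 2 * s - u < ∑ i ∈ Finset.range J, coeff i q :=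
    (h.hasSum.tendsto_sum_nat.eventually (lt_mem_nhds (by linarith))).exists
  have htail : ∀ᶠ n in atTop,
      (∑ i ∈ Finset.Ico J (n + 1), coeff i q * coeff (n - i) q) / coeff n q < u :=
    (h.tendsto_tail J).eventually (gt_mem_nhds (by linarith))
  obtain ⟨M, hM, hJM, hM0⟩ := ((eventually_forall_ge_atTop.2 (htail.and h.eventually_pos)).and
    ((eventually_ge_atTop J).and (eventually_gt_atTop 0))).exists
  refine ⟨M, hM0, fun n hn => ⟨(hM n hn).2, ?_⟩⟩
  refine le_trans (Finset.sum_le_sum_of_subset_of_nonneg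
    (Finset.Ico_subset_Ico_left hJM) fun i _ _ => ?_) ((div_lt_iff₀ (hM n hn).2).1 (hM n hn).1).le
  exact mul_nonneg (h.coeff_nonneg _) (h.coeff_nonneg _)

theorem exists_head_le (h : IsUnitSubexponential q s) (M : ℕ) :
    ∃ C ≥ 0, ∀ n, 0 < coeff n q → ∀ k,
      ∑ i ∈ Finset.range M, coeff i (q ^ k) * coeff (n - i) q ≤ C * s ^ k * coeff n q := by
  obtain ⟨C, hC⟩ := (h.tendsto_head 1 M).bddAbove_range
  refine ⟨max C 0, le_max_right _ _, fun n hn k => ?_⟩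
  have hCn : ∑ i ∈ Finset.range M, coeff (n - i) q ≤ C * coeff n q := by
    simpa [div_le_iff₀ hn] using hC (Set.mem_range_self n)
  calc ∑ i ∈ Finset.range M, coeff i (q ^ k) * coeff (n - i) q
      ≤ ∑ i ∈ Finset.range M, s ^ k * coeff (n - i) q := by
        gcongr with i _
        · exact h.coeff_nonneg _
        · exact h.coeff_pow_le k i
    _ = s ^ k * ∑ i ∈ Finset.range M, coeff (n - i) q := (Finset.mul_sum ..).symm
    _ ≤ s ^ k * (max C 0 * coeff n q) := by
        have := h.sum_pos
        gcongr
        exact hCn.trans (by gcongr; exact le_max_left _ _)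
    _ = max C 0 * s ^ k * coeff n q := by ring

theorem exists_coeff_pow_le (h : IsUnitSubexponential q s) {t : ℝ} (ht : s < t) :
    ∃ B, ∀ᶠ n in atTop, ∀ k, coeff n (q ^ k) ≤ B * t ^ k * coeff n q := by
  have hs := h.sum_pos
  obtain ⟨u, hsu, hut⟩ := exists_between ht
  obtain ⟨M, hM, htail⟩ := h.exists_tail_le hsu
  obtain ⟨C, hC, hhead⟩ := h.exists_head_le M
  have : 0 ≤ C / (t - u) := div_nonneg hC (sub_pos.2 hut).le
  have ht0 : 0 < t := hs.trans ht
  -- `C / (t - u)` is the fixed point of the recursion `B ↦ (C + B * u) / t` below.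
  refine ⟨C / (t - u), (eventually_ge_atTop M).mono fun n hn k => ?_⟩
  induction k generalizing n with
  | zero =>
    rw [pow_zero, coeff_one, if_neg (by omega)]
    exact mul_nonneg (by positivity) (h.coeff_nonneg n)
  | succ k ih =>
    obtain ⟨hpos, htail⟩ := htail n hn
    have hrest : ∑ i ∈ Finset.Ico M (n + 1), coeff i (q ^ k) * coeff (n - i) q ≤
        C / (t - u) * t ^ k * (u * coeff n q) := by
      have hpow : ∀ i ≥ M, |coeff i (q ^ k)| ≤ C / (t - u) * t ^ k * coeff i q := fun i hi => by
        rw [abs_of_nonneg (coeff_pow_nonneg h.coeff_nonneg k i)]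
        exact ih i hi
      refine (le_abs_self _).trans ((h.abs_tail_le hpow n).trans ?_)
      gcongr
    calc coeff n (q ^ (k + 1))
        = ∑ i ∈ Finset.range M, coeff i (q ^ k) * coeff (n - i) q +
            ∑ i ∈ Finset.Ico M (n + 1), coeff i (q ^ k) * coeff (n - i) q := by
          rw [pow_succ, coeff_mul_eq_sum_range_add_sum_Ico _ _ (by omega : M ≤ n + 1)]
      _ ≤ C * t ^ k * coeff n q + C / (t - u) * t ^ k * (u * coeff n q) := by
          refine add_le_add ((hhead n hpos k).trans ?_) hrest
          gcongr
      _ = C / (t - u) * t ^ (k + 1) * coeff n q := by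
          have := (sub_pos.2 hut).ne'
          field_simp
          ring

end IsUnitSubexponential

/-- The series with coefficients `g_{d m} ρ ^ {d m}`: the variable is rescaled by `ρ` and only the
coefficients at multiples of `d` are kept. -/
noncomputable def spanSeries (d : ℕ) (g : PowerSeries ℝ) (ρ : ℝ) : PowerSeries ℝ :=
  mk fun m => coeff (d * m) g * ρ ^ (d * m)

theorem coeff_spanSeries (d : ℕ) (g : PowerSeries ℝ) (ρ : ℝ) (m : ℕ) :
    coeff m (spanSeries d g ρ) = coeff (d * m) g * ρ ^ (d * m) := coeff_mk _ _

theorem atTop_inf_principal_dvd {d : ℕ} (hd : 1 ≤ d) :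
    (atTop ⊓ 𝓟 {n : ℕ | d ∣ n}) = map (fun m : ℕ => d * m) atTop := by
  ext S
  simp only [mem_inf_principal, mem_map, mem_atTop_sets, Set.mem_ofPred_eq, Set.mem_preimage]
  constructor
  · rintro ⟨a, ha⟩
    exact ⟨a, fun b hb => ha (d * b) (hb.trans (Nat.le_mul_of_pos_left b hd)) (dvd_mul_right d b)⟩
  · rintro ⟨a, ha⟩
    refine ⟨d * a, ?_⟩
    rintro _ hb ⟨c, rfl⟩
    exact ha c (Nat.le_of_mul_le_mul_left hb hd)

theorem neBot_atTop_inf_principal_dvd {d : ℕ} (hd : 1 ≤ d) :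
    (atTop ⊓ 𝓟 {n : ℕ | d ∣ n}).NeBot := by
  rw [atTop_inf_principal_dvd hd]
  infer_instance

namespace IsSubexponential

variable {d : ℕ} {g : PowerSeries ℝ} {ρ : ℝ}

theorem hasSum_rescale (h : IsSubexponential d g ρ) :
    HasSum (fun n => coeff n (rescale ρ g)) (seriesValue g ρ) := by
  simpa only [coeff_rescale, mul_comm, seriesValue] using h.summable.hasSum

theorem hasSum_coeff_pow (h : IsSubexponential d g ρ) (k : ℕ) :
    HasSum (fun n => coeff n (g ^ k) * ρ ^ n) (seriesValue g ρ ^ k) := by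
  have hpow := _root_.hasSum_coeff_pow h.hasSum_rescale k
  simpa only [← map_pow, coeff_rescale, mul_comm] using hpow

theorem rescale_eq_expand_spanSeries (h : IsSubexponential d g ρ) :
    rescale ρ g = expand d (Nat.one_le_iff_ne_zero.1 h.one_le_span) (spanSeries d g ρ) := by
  ext n
  rw [coeff_rescale]
  by_cases hn : d ∣ n
  · obtain ⟨m, rfl⟩ := hn
    rw [coeff_expand_mul, coeff_spanSeries, mul_comm]
  · rw [coeff_expand_of_not_dvd _ _ _ hn, h.coeff_eq_zero n hn, mul_zero]

theorem coeff_spanSeries_pow (h : IsSubexponential d g ρ) (k m : ℕ) :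
    coeff m (spanSeries d g ρ ^ k) = coeff (d * m) (g ^ k) * ρ ^ (d * m) := by
  rw [mul_comm, ← coeff_rescale, map_pow (rescale ρ), h.rescale_eq_expand_spanSeries, ← map_pow,
    coeff_expand_mul]

theorem coeff_spanSeries_pow_div (h : IsSubexponential d g ρ) (k m : ℕ) :
    coeff m (spanSeries d g ρ ^ k) / coeff m (spanSeries d g ρ) =
      coeff (d * m) (g ^ k) / coeff (d * m) g := by
  rw [h.coeff_spanSeries_pow, coeff_spanSeries,
    mul_div_mul_right _ _ (pow_pos h.radius_pos _).ne']

theorem hasSum_spanSeries (h : IsSubexponential d g ρ) :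
    HasSum (fun m => coeff m (spanSeries d g ρ)) (seriesValue g ρ) := by
  have hd := Nat.one_le_iff_ne_zero.1 h.one_le_span
  refine (((mul_right_injective₀ hd).hasSum_iff fun n hn => ?_).2 h.hasSum_rescale).congr_fun
    fun m => ?_
  · rw [h.rescale_eq_expand_spanSeries, coeff_expand_of_not_dvd]
    rintro ⟨m, rfl⟩
    exact hn ⟨m, rfl⟩
  · simp [h.rescale_eq_expand_spanSeries, coeff_expand_mul]

theorem seriesValue_pos (h : IsSubexponential d g ρ) : 0 < seriesValue g ρ := by
  have hterm (n : ℕ) : 0 ≤ coeff n g * ρ ^ n :=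
    mul_nonneg (h.coeff_nonneg n) (pow_pos h.radius_pos n).le
  have hg : g ≠ 0 := by
    rintro rfl
    exact ENNReal.ofReal_ne_top (h.radius_eq.symm.trans seriesRadius_zero)
  obtain ⟨n, hn⟩ := exists_coeff_ne_zero_iff_ne_zero.2 hg
  exact h.summable.tsum_pos hterm n
    (mul_pos ((h.coeff_nonneg n).lt_of_ne' hn) (pow_pos h.radius_pos n))

theorem isUnitSubexponential_spanSeries (h : IsSubexponential d g ρ) :
    IsUnitSubexponential (spanSeries d g ρ) (seriesValue g ρ) := by
  have hρ := h.radius_pos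
  have hconv := h.convolution
  have hratio := h.ratio
  rw [atTop_inf_principal_dvd h.one_le_span, tendsto_map'_iff] at hconv hratio
  refine ⟨fun m => ?_, h.hasSum_spanSeries, ?_, ?_, ?_⟩
  · rw [coeff_spanSeries]
    exact mul_nonneg (h.coeff_nonneg _) (by positivity)
  · filter_upwards [hconv.eventually (lt_mem_nhds (mul_pos two_pos h.seriesValue_pos))] with m hm
    rw [coeff_spanSeries]
    refine mul_pos ((h.coeff_nonneg _).lt_of_ne fun h0 => ?_) (by positivity)
    simp [← h0] at hm
  · have hlim := hratio.div_const (ρ ^ d)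
    rw [div_self (by positivity)] at hlim
    refine hlim.congr fun m => ?_
    simp only [Function.comp, coeff_spanSeries, mul_add, mul_one, pow_add]
    field_simp
  · refine hconv.congr fun m => ?_
    rw [h.coeff_spanSeries_pow_div, pow_two, coeff_mul, div_eq_inv_mul, Function.comp]

theorem eventually_coeff_pos (h : IsSubexponential d g ρ) :
    ∀ᶠ n in atTop ⊓ 𝓟 {n : ℕ | d ∣ n}, 0 < coeff n g := by
  rw [atTop_inf_principal_dvd h.one_le_span, eventually_map]
  filter_upwards [h.isUnitSubexponential_spanSeries.eventually_pos] with m hm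
  rw [coeff_spanSeries] at hm
  exact pos_of_mul_pos_left hm (pow_pos h.radius_pos _).le

theorem tendsto_coeff_pow (h : IsSubexponential d g ρ) (k : ℕ) :
    Tendsto (fun n => coeff n (g ^ k) / coeff n g) (atTop ⊓ 𝓟 {n : ℕ | d ∣ n})
      (𝓝 (k * seriesValue g ρ ^ (k - 1))) := by
  rw [atTop_inf_principal_dvd h.one_le_span, tendsto_map'_iff]
  exact (h.isUnitSubexponential_spanSeries.tendsto_coeff_pow k).congr
    (h.coeff_spanSeries_pow_div k)

theorem exists_coeff_pow_le (h : IsSubexponential d g ρ) {t : ℝ} (ht : seriesValue g ρ < t) :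
    ∃ B, ∀ᶠ n in atTop ⊓ 𝓟 {n : ℕ | d ∣ n}, ∀ k, coeff n (g ^ k) / coeff n g ≤ B * t ^ k := by
  obtain ⟨B, hB⟩ := h.isUnitSubexponential_spanSeries.exists_coeff_pow_le ht
  refine ⟨B, ?_⟩
  rw [atTop_inf_principal_dvd h.one_le_span, eventually_map]
  filter_upwards [hB, h.isUnitSubexponential_spanSeries.eventually_pos] with m hm hpos k
  rw [← h.coeff_spanSeries_pow_div, div_le_iff₀ hpos]
  exact hm k

end IsSubexponential

/-- The total weight of the `f ∘ g`-structures of size `n` with `k` components, relative to the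
total weight of the `g`-structures of size `n`. -/
noncomputable def componentWeight (f g : PowerSeries ℝ) (n k : ℕ) : ℝ :=
  coeff k f * (coeff n (g ^ k) / coeff n g)

/-- The coefficient of `z ^ k` in `z f'(s z)`, which is the limit of `componentWeight f g n k` when
`g` has the value `s` at its radius of convergence. -/
noncomputable def limitComponentWeight (f : PowerSeries ℝ) (s : ℝ) (k : ℕ) : ℝ :=
  coeff k f * (k * s ^ (k - 1))

theorem tsum_limitComponentWeight_pos {f : PowerSeries ℝ} {s : ℝ}
    (hsum : Summable (limitComponentWeight f s)) (hf : ∀ k, 0 ≤ coeff k f) (hs : 0 < s)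
    (hfpos : ∃ k, 1 ≤ k ∧ 0 < coeff k f) : 0 < ∑' k, limitComponentWeight f s k := by
  obtain ⟨k, hk, hfk⟩ := hfpos
  refine hsum.tsum_pos (fun j => mul_nonneg (hf j) (by positivity)) k ?_
  have : (0 : ℝ) < k := by exact_mod_cast hk
  rw [limitComponentWeight]
  positivity

theorem IsSubexponential.dominatedTendsto_componentWeight {d : ℕ} {f g : PowerSeries ℝ} {ρ : ℝ}
    (h : IsSubexponential d g ρ) (hf : ∀ k, 0 ≤ coeff k f)
    (hrad : ENNReal.ofReal (seriesValue g ρ) < seriesRadius f) :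
    ∃ D : ℕ → ℝ, DominatedTendsto (atTop ⊓ 𝓟 {n : ℕ | d ∣ n}) (componentWeight f g)
        (limitComponentWeight f (seriesValue g ρ)) D ∧
      ∀ m : ℕ, Summable fun k => D k * |(k : ℝ) ^ m| := by
  obtain ⟨t, ht0, hst, htr⟩ := ENNReal.lt_iff_exists_real_btwn.1 hrad
  obtain ⟨B, hB⟩ := h.exists_coeff_pow_le (ENNReal.ofReal_lt_ofReal_iff_of_nonneg
    h.seriesValue_pos.le |>.1 hst)
  have hmoment (m : ℕ) : Summable fun k => coeff k f * (B * t ^ k) * |(k : ℝ) ^ m| := by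
    refine ((summable_coeff_mul_pow_mul_pow ht0 htr m).mul_left B).congr fun k => ?_
    rw [abs_of_nonneg (by positivity)]
    ring
  refine ⟨fun k => coeff k f * (B * t ^ k), ?_, hmoment⟩
  refine ⟨.of_forall fun n k => ?_, ?_, fun k => ?_, ?_⟩
  · exact mul_nonneg (hf k)
      (div_nonneg (coeff_pow_nonneg h.coeff_nonneg k n) (h.coeff_nonneg n))
  · exact hB.mono fun n hn k => mul_le_mul_of_nonneg_left (hn k) (hf k)
  · exact (h.tendsto_coeff_pow k).const_mul _
  · simpa using hmoment 0

end PowerSeries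

section Enumeration

open Finset PowerSeries

section Fibers

variable {U κ : Type*} [Fintype U]

/-- The sizes of the fibres of `c`, encoded as the exponent of the monomial `∏ u, X (c u)`. -/
noncomputable def fiberCard (c : U → κ) : κ →₀ ℕ := ∑ u, Finsupp.single (c u) 1

theorem fiberCard_apply (c : U → κ) (i : κ) : fiberCard c i = Nat.card (c ⁻¹' {i}) := by
  classical
  rw [fiberCard, Finsupp.finsetSum_apply, Nat.card_eq_fintype_card, Fintype.card_subtype]
  simp [Finsupp.single_apply]

variable [Fintype κ]

theorem sum_fiberCard (c : U → κ) : ∑ i, fiberCard c i = Fintype.card U := by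
  classical
  simp only [fiberCard, Finsupp.finsetSum_apply]
  rw [sum_comm]
  simp

theorem factorial_sum_mul_prod_div_factorial (m : κ →₀ ℕ) (x : κ → ℝ) :
    ((∑ i, m i).factorial : ℝ) * ∏ i, x i / (m i).factorial = m.multinomial * ∏ i, x i := by
  have hm := Nat.multinomial_spec univ m
  rw [Finsupp.multinomial_of_support_subset (subset_univ _)] at hm
  have hne : ∏ i, ((m i).factorial : ℝ) ≠ 0 := by positivity
  rw [← hm, prod_div_distrib]
  push_cast
  field_simp

variable [DecidableEq U]

theorem sum_X_pow_card :
    (∑ i : κ, MvPolynomial.X i : MvPolynomial κ ℕ) ^ Fintype.card U =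
      ∑ c : U → κ, MvPolynomial.monomial (fiberCard c) 1 := by
  simp_rw [fiberCard, MvPolynomial.monomial_sum_one, ← Fintype.piFinset_univ]
  rw [← card_univ, ← prod_const, prod_univ_sum]
  rfl

theorem card_filter_fiberCard_eq [DecidableEq κ] {m : κ →₀ ℕ} (hm : ∑ i, m i = Fintype.card U) :
    #{c : U → κ | fiberCard c = m} = m.multinomial := by
  have hcoeff := MvPolynomial.coeff_sum_X_pow_of_fintype (R := ℕ) m (Fintype.card U)
  rw [if_pos ((m.sum_fintype _ fun _ => rfl).trans hm), sum_X_pow_card,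
    MvPolynomial.coeff_sum] at hcoeff
  simp_rw [MvPolynomial.coeff_monomial] at hcoeff
  rw [card_filter]
  exact hcoeff

theorem sum_prod_card_fiber (a : ℕ → ℝ) :
    ∑ c : U → κ, ∏ i, a (Nat.card (c ⁻¹' {i})) =
      (Fintype.card U).factorial *
        coeff (Fintype.card U) ((mk fun n => a n / n.factorial) ^ Fintype.card κ) := by
  classical
  have hmem (m : κ →₀ ℕ) : m ∈ univ.finsuppAntidiag (Fintype.card U) ↔
      ∑ i, m i = Fintype.card U := by
    simp
  simp_rw [← fiberCard_apply]
  rw [← sum_fiberwise_of_maps_to fun c _ => (hmem (fiberCard c)).2 (sum_fiberCard c),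
    ← card_univ (α := κ), ← prod_const, coeff_prod, mul_sum]
  refine sum_congr rfl fun m hm => ?_
  rw [hmem] at hm
  simp only [coeff_mk]
  rw [← hm, factorial_sum_mul_prod_div_factorial, ← card_filter_fiberCard_eq hm, ← nsmul_eq_mul]
  exact sum_eq_card_nsmul fun c hc => by rw [(mem_filter.1 hc).2]

end Fibers

section Partitions

variable {U κ : Type*}

/-- An equivalence relation with a numbering of its classes by `κ` is the same as a surjection
onto `κ`. -/
def numberedQuotientToSurjection (e : Σ r : Setoid U, Quotient r ≃ κ) :
    {c : U → κ // Function.Surjective c} :=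
  ⟨fun x => e.2 ⟦x⟧, e.2.surjective.comp Quotient.mk_surjective⟩

theorem numberedQuotientToSurjection_bijective :
    Function.Bijective (numberedQuotientToSurjection (U := U) (κ := κ)) := by
  constructor
  · rintro ⟨r, e⟩ ⟨r', e'⟩ h
    have hval (x : U) : e ⟦x⟧ = e' ⟦x⟧ := congrFun (congrArg Subtype.val h) x
    obtain rfl : r = r' := Setoid.ext fun x y => by
      rw [← Quotient.eq, ← e.apply_eq_iff_eq, hval, hval, e'.apply_eq_iff_eq, Quotient.eq]
    exact congrArg _ (Equiv.ext (Quotient.ind hval))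
  · rintro ⟨c, hc⟩
    exact ⟨⟨Setoid.ker c, Setoid.quotientKerEquivOfSurjective c hc⟩, rfl⟩

theorem numberedQuotientToSurjection_preimage (r : Setoid U) (e : Quotient r ≃ κ)
    (q : Quotient r) : (numberedQuotientToSurjection ⟨r, e⟩).1 ⁻¹' {e q} =
      Setoid.quotientEquivClasses r q := by
  induction q using Quotient.ind with | _ y
  rw [Setoid.quotientEquivClasses_mk_eq]
  ext x
  exact e.apply_eq_iff_eq.trans Quotient.eq

variable [Fintype κ]

theorem prod_card_fiber_numberedQuotient (r : Setoid U) (e : Quotient r ≃ κ) (a : ℕ → ℝ) :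
    ∏ i, a (Nat.card ((numberedQuotientToSurjection ⟨r, e⟩).1 ⁻¹' {i})) =
      ∏ᶠ Q : r.classes, a (Nat.card (Q : Set U)) := by
  rw [← finprod_comp_equiv (e.symm.trans r.quotientEquivClasses), ← finprod_eq_prod_of_fintype]
  refine finprod_congr fun i => ?_
  obtain ⟨q, rfl⟩ := e.surjective i
  rw [numberedQuotientToSurjection_preimage]
  simp

variable [Fintype U] [DecidableEq U] [DecidableEq κ]

theorem sum_surjective_prod_card_fiber {a : ℕ → ℝ} (ha : a 0 = 0) :
    ∑ c : {c : U → κ // Function.Surjective c}, ∏ i, a (Nat.card (c.1 ⁻¹' {i})) =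
      ∑ c : U → κ, ∏ i, a (Nat.card (c ⁻¹' {i})) := by
  classical
  rw [← sum_subtype (univ.filter Function.Surjective) (by simp)
    fun c : U → κ => ∏ i, a (Nat.card (c ⁻¹' {i}))]
  refine sum_subset (subset_univ _) fun c _ hc => ?_
  obtain ⟨i, hi⟩ : ∃ i, ∀ x, c x ≠ i := by simpa [Function.Surjective] using hc
  refine prod_eq_zero (mem_univ i) ?_
  rw [Set.preimage_singleton_eq_empty.2 fun ⟨x, hx⟩ => hi x hx]
  simpa using ha

end Partitions

theorem factorial_mul_sum_partitions (U : Type*) [Finite U] (k : ℕ) {a : ℕ → ℝ} (ha : a 0 = 0) :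
    k.factorial * ∑ᶠ p : {p : Set (Set U) // Setoid.IsPartition p},
        (if Nat.card p.1 = k then ∏ᶠ Q : p.1, a (Nat.card (Q : Set U)) else 0) =
      (Nat.card U).factorial *
        coeff (Nat.card U) ((mk fun n => a n / n.factorial) ^ k) := by
  classical
  have := Fintype.ofFinite U
  have := Fintype.ofInjective _ fun _ _ : Setoid U => Setoid.classes_inj.2
  have (r : Setoid U) := Fintype.ofFinite (Quotient r)
  let classesEquiv : Setoid U ≃ {p : Set (Set U) // Setoid.IsPartition p} :=
    (Setoid.Partition.orderIso U).toEquiv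
  have hnumberings (r : Setoid U) : ((Fintype.card (Quotient r ≃ Fin k) : ℕ) : ℝ) =
      if Nat.card r.classes = k then (k.factorial : ℝ) else 0 := by
    rw [← Nat.card_congr r.quotientEquivClasses]
    split_ifs with hk
    · rw [Fintype.card_equiv (Finite.equivFinOfCardEq hk), ← Nat.card_eq_fintype_card, hk]
    · have : IsEmpty (Quotient r ≃ Fin k) := ⟨fun e => hk (by rw [Nat.card_congr e, Nat.card_fin])⟩
      simp
  have hcolor := sum_prod_card_fiber (U := U) (κ := Fin k) a
  rw [Fintype.card_fin, ← sum_surjective_prod_card_fiber ha,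
    ← numberedQuotientToSurjection_bijective.sum_comp, Fintype.sum_sigma] at hcolor
  rw [Nat.card_eq_fintype_card, ← hcolor, ← finsum_comp_equiv classesEquiv,
    finsum_eq_sum_of_fintype, mul_sum]
  refine sum_congr rfl fun r _ => ?_
  simp_rw [prod_card_fiber_numberedQuotient, sum_const, nsmul_eq_mul, card_univ, hnumberings,
    mul_ite, ite_mul, mul_zero, zero_mul]
  rfl

end Enumeration

namespace WeightedSpecies

open PowerSeries (coeff)

section Total

variable (A : WeightedSpecies.{u})

/-- The total weight of the structures on a label set. -/
noncomputable def total (U : Type) [Finite U] : ℝ := ∑ᶠ x : A.obj U, (A.weight x : ℝ)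

/-- The bijection between structures induced by a bijection of the label sets. -/
def mapEquiv {U V : Type} [Finite U] [Finite V] (σ : U ≃ V) : A.obj U ≃ A.obj V where
  toFun := A.map σ
  invFun := A.map σ.symm
  left_inv x := by rw [← A.map_trans, Equiv.self_trans_symm, A.map_refl]
  right_inv x := by rw [← A.map_trans, Equiv.symm_trans_self, A.map_refl]

theorem total_congr {U V : Type} [Finite U] [Finite V] (σ : U ≃ V) : A.total U = A.total V := by
  rw [total, total, ← finsum_comp_equiv (A.mapEquiv σ)]
  exact finsum_congr fun x => congrArg _ (A.weight_map σ x).symm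

theorem total_eq_card (U : Type) [Finite U] : A.total U = A.total (Fin (Nat.card U)) :=
  A.total_congr (Finite.equivFin U)

theorem total_nonneg (U : Type) [Finite U] : 0 ≤ A.total U :=
  finsum_nonneg fun _ => NNReal.coe_nonneg _

theorem egf_eq_mk : A.egf = PowerSeries.mk fun n => A.total (Fin n) / n.factorial := rfl

theorem coeff_egf (n : ℕ) : coeff n A.egf = A.total (Fin n) / n.factorial :=
  PowerSeries.coeff_mk _ _

theorem coeff_egf_nonneg (n : ℕ) : 0 ≤ coeff n A.egf := by
  rw [coeff_egf]
  exact div_nonneg (A.total_nonneg _) (Nat.cast_nonneg _)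

theorem coeff_zero_egf_of_isEmpty (h : IsEmpty (A.obj Empty)) : coeff 0 A.egf = 0 := by
  rw [coeff_egf, ← A.total_congr (Equiv.equivOfIsEmpty Empty (Fin 0)), total, finsum_of_isEmpty,
    zero_div]

theorem coeff_egf_derived (n : ℕ) :
    coeff n A.derived.egf = (n + 1) * coeff (n + 1) A.egf := by
  have h : A.derived.total (Fin n) = A.total (Fin (n + 1)) :=
    A.total_congr (U := Option (Fin n)) (Fintype.equivFinOfCardEq (by simp))
  rw [coeff_egf, coeff_egf, h, Nat.factorial_succ]
  push_cast
  field_simp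

end Total

section Composition

variable (F : WeightedSpecies.{u}) (G : WeightedSpecies.{v})

/-- A composite structure as a partition with an outer structure and a family of inner ones. -/
def compEquiv (U : Type) [Finite U] :
    CompositeStructure F G U ≃ Σ p : {p : Set (Set U) // Setoid.IsPartition p},
      F.obj p.1 × ((Q : p.1) → G.obj (Q : Set U)) where
  toFun s := ⟨⟨s.parts, s.isPartition⟩, s.outer, s.inner⟩
  invFun t := ⟨t.1.1, t.1.2, t.2.1, t.2.2⟩
  left_inv _ := rfl
  right_inv _ := rfl

theorem finsum_prod_weight {U : Type} [Finite U] (p : Set (Set U)) :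
    ∑ᶠ y : (Q : p) → G.obj (Q : Set U), ∏ᶠ Q, (G.weight (y Q) : ℝ) =
      ∏ᶠ Q : p, G.total (Q : Set U) := by
  classical
  have := Fintype.ofFinite p
  have (Q : p) := Fintype.ofFinite (G.obj (Q : Set U))
  simp_rw [total, finsum_eq_sum_of_fintype, finprod_eq_prod_of_fintype]
  rw [Finset.prod_univ_sum, Fintype.piFinset_univ]

theorem finsum_weight_of_parts {U : Type} [Finite U]
    (p : {p : Set (Set U) // Setoid.IsPartition p}) :
    ∑ᶠ t : F.obj p.1 × ((Q : p.1) → G.obj (Q : Set U)),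
        (((compEquiv F G U).symm ⟨p, t⟩).weight : ℝ) =
      F.total p.1 * ∏ᶠ Q : p.1, G.total (Q : Set U) := by
  classical
  have := Fintype.ofFinite p.1
  have := Fintype.ofFinite (F.obj p.1)
  have (Q : p.1) := Fintype.ofFinite (G.obj (Q : Set U))
  rw [← finsum_prod_weight, total]
  simp_rw [finsum_eq_sum_of_fintype]
  rw [Fintype.sum_prod_type, Finset.sum_mul_sum]
  refine Finset.sum_congr rfl fun x _ => Finset.sum_congr rfl fun y _ => ?_
  change ((F.weight x * ∏ᶠ Q : p.1, G.weight (y Q) : ℝ≥0) : ℝ) = _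
  simp_rw [finprod_eq_prod_of_fintype]
  push_cast
  rfl

theorem finsum_weight_numComponents_eq (hG : coeff 0 G.egf = 0) (U : Type) [Finite U] (k : ℕ) :
    (∑ᶠ s : CompositeStructure F G U, if s.numComponents = k then (s.weight : ℝ) else 0) =
      (Nat.card U).factorial * (coeff k F.egf * coeff (Nat.card U) (G.egf ^ k)) := by
  classical
  have := Fintype.ofFinite {p : Set (Set U) // Setoid.IsPartition p}
  have (p : {p : Set (Set U) // Setoid.IsPartition p}) :=
    Fintype.ofFinite (F.obj p.1 × ((Q : p.1) → G.obj (Q : Set U)))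
  have hpartitions := factorial_mul_sum_partitions U k (a := fun n => G.total (Fin n))
    (by simpa [coeff_egf] using hG)
  rw [← egf_eq_mk] at hpartitions
  rw [mul_left_comm, ← hpartitions, coeff_egf, div_mul_eq_mul_div, mul_div_assoc,
    mul_div_cancel_left₀ _ (by positivity : (k.factorial : ℝ) ≠ 0),
    ← finsum_comp_equiv (compEquiv F G U).symm, finsum_eq_sum_of_fintype, finsum_eq_sum_of_fintype,
    Fintype.sum_sigma, Finset.mul_sum]
  refine Finset.sum_congr rfl fun p _ => ?_
  change ∑ t, (if Nat.card p.1 = k then (((compEquiv F G U).symm ⟨p, t⟩).weight : ℝ) else 0) = _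
  split_ifs with hk
  · rw [← finsum_eq_sum_of_fintype, finsum_weight_of_parts, F.total_eq_card, hk]
    simp_rw [← G.total_eq_card]
  · simp

end Composition

end WeightedSpecies

theorem tsum_ite_coe_eq_ofReal_finsum {α : Type*} [Finite α] (w : α → ℝ≥0) (p : α → Prop)
    [DecidablePred p] : (∑' a, if p a then (w a : ℝ≥0∞) else 0) =
      ENNReal.ofReal (∑ᶠ a, if p a then (w a : ℝ) else 0) := by
  have := Fintype.ofFinite α
  have hcoe (a : α) : (if p a then (w a : ℝ) else 0) = ((if p a then w a else 0 : ℝ≥0) : ℝ) := by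
    split_ifs <;> rfl
  simp_rw [tsum_fintype, finsum_eq_sum_of_fintype, hcoe]
  rw [ENNReal.ofReal_sum_of_nonneg fun _ _ => NNReal.coe_nonneg _]
  simp [ENNReal.ofReal_coe_nnreal, apply_ite]

namespace WeightedSpecies

open PowerSeries (coeff)

variable {F : WeightedSpecies.{u}} {G : WeightedSpecies.{v}}

theorem tsum_weight_components_eq (hG : coeff 0 G.egf = 0) (n k : ℕ) :
    (∑' s : (F.comp G).obj (Fin n), if components s = k then ((F.comp G).weight s : ℝ≥0∞) else 0) =
      ENNReal.ofReal (n.factorial * (coeff k F.egf * coeff n (G.egf ^ k))) := by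
  rw [tsum_ite_coe_eq_ofReal_finsum]
  refine congrArg _ ((finsum_weight_numComponents_eq F G hG (Fin n) k).trans ?_)
  rw [Nat.card_fin]

theorem map_components_sizedLaw (hG : coeff 0 G.egf = 0) {n : ℕ} (hn : 0 < coeff n G.egf) :
    ((F.comp G).sizedLaw n).map (fun s => components s) =
      weightLaw (componentWeight F.egf G.egf n) := by
  have hscale : 0 < (n.factorial : ℝ) * coeff n G.egf := by positivity
  rw [sizedLaw, map_proportionalLaw _ measurable_from_top, ← weightLaw_const_mul _ hscale,
    weightLaw]
  refine congrArg proportionalLaw (funext fun k => (tsum_weight_components_eq hG n k).trans ?_)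
  rw [componentWeight]
  field_simp

theorem tsum_boltzmannWeight_components_eq (hG : coeff 0 G.egf = 0) {ρ : ℝ} (hρ : 0 ≤ ρ)
    (n k : ℕ) :
    (∑' s : (F.comp G).obj (Fin n), if components s = k then
        ENNReal.ofReal ((F.comp G).weight s * ρ ^ n / n.factorial) else 0) =
      ENNReal.ofReal (coeff k F.egf * (coeff n (G.egf ^ k) * ρ ^ n)) := by
  have hterm (s : (F.comp G).obj (Fin n)) : (if components s = k then
      ENNReal.ofReal ((F.comp G).weight s * ρ ^ n / n.factorial) else 0) =
      ENNReal.ofReal (ρ ^ n / n.factorial) *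
        (if components s = k then ((F.comp G).weight s : ℝ≥0∞) else 0) := by
    rw [mul_ite, mul_zero, mul_div_assoc, ENNReal.ofReal_mul (NNReal.coe_nonneg _),
      ENNReal.ofReal_coe_nnreal, mul_comm]
  simp_rw [hterm]
  rw [ENNReal.tsum_mul_left, tsum_weight_components_eq hG, ← ENNReal.ofReal_mul (by positivity)]
  field_simp

theorem tsum_boltzmannWeight_components_universe_eq {d : ℕ} {ρ : ℝ} (hG : coeff 0 G.egf = 0)
    (hGd : IsSubexponential d G.egf ρ) (k : ℕ) :
    (∑' r : (F.comp G).Universe, if components r.2 = k then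
        ENNReal.ofReal ((F.comp G).weight r.2 * ρ ^ r.1 / r.1.factorial) else 0) =
      ENNReal.ofReal (coeff k F.egf * seriesValue G.egf ρ ^ k) := by
  have hρ := hGd.radius_pos.le
  have hsum := (hGd.hasSum_coeff_pow k).mul_left (coeff k F.egf)
  have hnonneg (n : ℕ) : 0 ≤ coeff k F.egf * (coeff n (G.egf ^ k) * ρ ^ n) :=
    mul_nonneg (coeff_egf_nonneg _ _)
      (mul_nonneg (coeff_pow_nonneg hGd.coeff_nonneg _ _) (by positivity))
  rw [← hsum.tsum_eq, ENNReal.ofReal_tsum_of_nonneg hnonneg hsum.summable]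
  exact (ENNReal.tsum_sigma' _).trans
    (tsum_congr fun n => tsum_boltzmannWeight_components_eq hG hρ n k)

theorem map_components_boltzmannLaw {d : ℕ} {ρ : ℝ} (hG : coeff 0 G.egf = 0)
    (hGd : IsSubexponential d G.egf ρ) :
    ((F.derived.comp G).boltzmannLaw ρ).map (fun r => 1 + components r.2) =
      weightLaw (limitComponentWeight F.egf (seriesValue G.egf ρ)) := by
  rw [boltzmannLaw, map_proportionalLaw _ measurable_from_top, weightLaw]
  refine congrArg proportionalLaw (funext fun k => ?_)
  rcases k with _ | k
  · simp [limitComponentWeight]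
  · simp_rw [add_comm 1, Nat.add_right_cancel_iff]
    rw [tsum_boltzmannWeight_components_universe_eq hG hGd, coeff_egf_derived,
      limitComponentWeight, Nat.add_sub_cancel]
    push_cast
    ring_nf

end WeightedSpecies

theorem proposition3p2 (F : WeightedSpecies.{u}) (G : WeightedSpecies.{v})
    (hG : IsEmpty (G.obj Empty))
    (hF : ∃ k : ℕ, 1 ≤ k ∧ 0 < PowerSeries.coeff k F.egf)
    (d : ℕ) (ρ : ℝ) (hGd : IsSubexponential d G.egf ρ)
    (hrad : ENNReal.ofReal (seriesValue G.egf ρ) < seriesRadius F.egf) :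
    -- the random structures exist
    (∀ᶠ n in atTop ⊓ 𝓟 {n : ℕ | d ∣ n}, IsProbabilityMeasure ((F.comp G).sizedLaw n)) ∧
    IsProbabilityMeasure ((F.derived.comp G).boltzmannLaw ρ) ∧
    -- convergence in total variation
    Tendsto (fun n : ℕ => tvDist
        (((F.comp G).sizedLaw n).map fun s => WeightedSpecies.components s)
        (((F.derived.comp G).boltzmannLaw ρ).map fun r => 1 + WeightedSpecies.components r.2))
      (atTop ⊓ 𝓟 {n : ℕ | d ∣ n}) (𝓝 0) ∧
    -- convergence of all moments
    ∀ k : ℕ,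
      Integrable (fun r => (1 + (WeightedSpecies.components r.2 : ℝ)) ^ k)
        ((F.derived.comp G).boltzmannLaw ρ) ∧
      Tendsto (fun n : ℕ =>
          ∫ s, (WeightedSpecies.components s : ℝ) ^ k ∂((F.comp G).sizedLaw n))
        (atTop ⊓ 𝓟 {n : ℕ | d ∣ n})
        (𝓝 (∫ r, (1 + (WeightedSpecies.components r.2 : ℝ)) ^ k
          ∂((F.derived.comp G).boltzmannLaw ρ))) := by
  have hG0 := G.coeff_zero_egf_of_isEmpty hG
  have := neBot_atTop_inf_principal_dvd hGd.one_le_span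
  obtain ⟨D, hdom, hmoment⟩ := hGd.dominatedTendsto_componentWeight F.coeff_egf_nonneg hrad
  have hpos := tsum_limitComponentWeight_pos hdom.summable_limit F.coeff_egf_nonneg
    hGd.seriesValue_pos hF
  have hsized := hGd.eventually_coeff_pos.mono fun n hn =>
    WeightedSpecies.map_components_sizedLaw (F := F) hG0 hn
  have hboltzmann := WeightedSpecies.map_components_boltzmannLaw (F := F) hG0 hGd
  have hmeas : AEMeasurable (fun r => 1 + WeightedSpecies.components r.2)
    ((F.derived.comp G).boltzmannLaw ρ) := measurable_from_top.aemeasurable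
  simp_rw [← Nat.cast_one_add]
  refine ⟨?_, ?_, ?_, fun k => ⟨?_, ?_⟩⟩
  · filter_upwards [hdom.isProbabilityMeasure_weightLaw hpos, hsized] with n hprob hn
    rw [← hn] at hprob
    exact Measure.isProbabilityMeasure_of_map fun s => WeightedSpecies.components s
  · have hprob := hdom.isProbabilityMeasure_weightLaw_limit hpos
    rw [← hboltzmann] at hprob
    exact Measure.isProbabilityMeasure_of_map fun r => 1 + WeightedSpecies.components r.2
  · rw [hboltzmann]
    exact (hdom.tendsto_tvDist_weightLaw hpos).congr' (hsized.mono fun n hn => by simp only [hn])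
  · rw [← Function.comp_def (fun j : ℕ => (j : ℝ) ^ k),
      ← integrable_map_measure (by fun_prop) hmeas, hboltzmann]
    exact hdom.integrable_weightLaw_limit hpos (hmoment k)
  · rw [← integral_map hmeas (f := fun j : ℕ => (j : ℝ) ^ k) (by fun_prop), hboltzmann]
    refine (hdom.tendsto_integral_weightLaw hpos (hmoment k)).congr' (hsized.mono fun n hn => ?_)
    rw [← hn, integral_map measurable_from_top.aemeasurable (by fun_prop)]
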